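/- **Setting.** Let $\mathcal L=\{<,\dots\}$ be a countable first-order language, let $\mathcal L^{S}$ be its expansion by Skolem functions for all formulas (including formulas with Skolem functions) and $T_{\mathrm{skolem}}$ the corresponding Skolem theory. Let $\theta$ be a strongly inaccessible cardinal and let $M$ be an $\mathcal L^{S}$-structure with $M\models T_{\mathrm{skolem}}$ in which $<$ is a linear order that is $\theta$-like (that is, $|M|=\theta$ and every element has fewer than $\theta$ predecessors). Let $M=\bigcup_{i<\theta}M_i$, where $\langle M_i ; i<\theta\rangle$ is a chain of elementary $\mathcal L^{S}$-submodels such that $M_j$ is a proper end extension of $M_i$ for $i<j<\theta$, and $M_i=\bigcup_{j<i}M_j$ for limit $i<\theta$. For $a\in M$ let $F(a)$ be the least $i<\theta$ with $a\in M_i$. For $X\subseteq M$, $[X]^r$ is the set of strictly increasing $r$-sequences from $X$, and for $A\subseteq M$, $[F|A]^{r,s}$ is the set of $\mathbf x=\langle\mathbf x_1,\dots,\mathbf x_s\rangle$ with $\mathbf x_i=\langle x_{i1},\dots,x_{ir}\rangle\in[A]^r$, $F(x_{ij})=F(x_{il})$ for all $i,j,l$, and $F(x_{11})<F(x_{21})<\dots<F(x_{s1})$;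 $[F]^{r,s}=[F|M]^{r,s}$. Here $r,s$ are positive integers. **Superlarge sets.** Let $1\le e\le s$ and $S\subseteq[F]^{r,s}$. In the game $G(S,e)$ player I plays a cardinal $\mu_1<\theta$, player II an ordinal $\beta_1<\theta$, then I plays $\mu_2<\theta$, II plays $\beta_2<\theta$, and so on until I plays $\mu_e<\theta$; the last move of II is a sequence $\langle\beta_{e+i} ; i<\theta\rangle$ of ordinals below $\theta$. Player II wins if the sequence $\beta_1<\dots<\beta_e<\dots<\beta_{e+i}<\cdots$ $(i<\theta)$ is strictly increasing and there are sets $X_k\subseteq F^{-1}(\beta_k)$ with $|X_k|=\mu_k$ for $1\le k\le e$, and sets $X_{e+i}\subseteq F^{-1}(\beta_{e+i})$ for $1\le i<\theta$, such that $\sup\{|X_{e+i}| ; i<\theta\}=\theta$ and $$\prod_{1\le k\le e}[X_k]^r\times\Big[F\Big|\bigcup_{1\le i<\theta}X_{e+i}\Big]^{r,s-e}\subseteq S,$$ where for $e=s$ the last factor is omitted. The set $S$ is *$e$-superlarge* if II has a winning strategy in $G(S,e)$. **Sentences of type $\Sigma_1^*(\mathrm{iv})$.** Let $C^*=\{c_{ij}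 ; i,j<\omega\}$ be new constants, ordered lexicographically by their indices. A sentence $\sigma$ of type $\Sigma_1^*(\mathrm{iv})$ is an $\mathcal L^S(C^*)$-sentence of the form $$\tau(\bar c,c_{i_nj_{q+1}},\dots,c_{i_nj_n})<c_{(i_n-1)j}\ \longrightarrow\ \tau(\bar c,c_{i_nj_{q+1}},\dots,c_{i_nj_n})=\tau(\bar c,c_{ul_1},\dots,c_{ul_{n-q}}),$$ where $\tau(v_1,\dots,v_n)$ is an $\mathcal L^S$-term, $0\le q<n$, $\bar c=\langle c_{i_1j_1},\dots,c_{i_qj_q}\rangle$ with $i_1,\dots,i_q<i_n$, $i_n>1$, $u\ge i_n$, and the sequences of constants substituted into $\tau$ are strictly increasing. Put $\iota(\sigma)=i_n$. For $\mathbf a\in[F]^{r,s}$, $M\models\sigma(\mathbf a)$ means that $\sigma$ holds in $M$ when each $c_{ij}$ is interpreted as $a_{ij}$. **Proposition.** Let $S\subseteq[F]^{r,s}$ be $e$-superlarge, where $1\le e<s$. Let $\sigma$ be a sentence of type $\Sigma_1^*(\mathrm{iv})$ such that all the constants $c_{ij}$ listed in the form of $\sigma$ displayed above satisfy $1\le i\le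 s$ and $1\le j\le r$, and let $\iota(\sigma)=e'>e$. Then there is an $e'$-superlarge set $S'\subseteq S$ such that $M\models\sigma(\mathbf a)$ for every $\mathbf a\in S'$. -/

import Mathlib

open FirstOrder Cardinal

universe u v w

namespace KeislerGame

/-! ### The Skolem expansion of a language -/

/-- The `k`-th stage of the Skolem expansion: at each step a function symbol is added for every
formula `ψ(x₀, …, xₙ₋₁, y)` of the previous stage. -/
def skolemStage (L : FirstOrder.Language.{u, u}) : ℕ → FirstOrder.Language.{u, u}
  | 0 => L
  | k + 1 => (skolemStage L k).sum (skolemStage L k).skolem₁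

/-- The language `Lˢ` obtained from `L` by adding Skolem functions for all formulas, including
those in which earlier Skolem functions occur (the union of all the stages). -/
def skolemLanguage (L : FirstOrder.Language.{u, u}) : FirstOrder.Language.{u, u} where
  Functions := fun n => L.Functions n ⊕ (Σ k : ℕ, (skolemStage L k).BoundedFormula Empty (n + 1))
  Relations := L.Relations

/-- The inclusion of the language `L` in `Lˢ`. -/
def skolemInclusion (L : FirstOrder.Language.{u, u}) : L →ᴸ skolemLanguage L where
  onFunction := fun _ f => Sum.inl f
  onRelation := fun _ R => R

/-- The map that sends each symbol of the Skolem language of the `k`-th stage to the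
corresponding Skolem function symbol of `Lˢ`. -/
def skolemSymbols (L : FirstOrder.Language.{u, u}) (k : ℕ) :
    (skolemStage L k).skolem₁ →ᴸ skolemLanguage L where
  onFunction := fun _ ψ => Sum.inr ⟨k, ψ⟩
  onRelation := fun _ R => Empty.elim R

/-- The inclusion of the `k`-th stage in `Lˢ`. -/
def skolemStageInclusion (L : FirstOrder.Language.{u, u}) : (k : ℕ) → (skolemStage L k →ᴸ skolemLanguage L)
  | 0 => skolemInclusion L
  | k + 1 => (skolemStageInclusion L k).sumElim (skolemSymbols L k)

/-- The Skolem axiom of a formula `ψ(x₀, …, xₙ₋₁, y)` with Skolem function `f`: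
`∀ x₀ … xₙ₋₁, (∃ y, ψ(x, y)) → ∃ y, (y = f(x) ∧ ψ(x, y))`. -/
def skolemAxiom {L' : FirstOrder.Language.{u, v}} {n : ℕ} (ψ : L'.BoundedFormula Empty (n + 1))
    (f : L'.Functions n) : L'.Sentence :=
  (ψ.ex.imp
    (((FirstOrder.Language.Term.var (Sum.inr (Fin.last n)) : L'.Term (Empty ⊕ Fin (n + 1))).bdEqual
      (FirstOrder.Language.Term.func f fun k => FirstOrder.Language.Term.var (Sum.inr k.castSucc))) ⊓ ψ).ex).alls

/-- The theory `T_skolem` in the language `Lˢ`. -/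
def skolemTheory (L : FirstOrder.Language.{u, u}) : (skolemLanguage L).Theory :=
  {φ | ∃ (n k : ℕ) (ψ : (skolemStage L k).BoundedFormula Empty (n + 1)),
    φ = skolemAxiom ((skolemStageInclusion L k).onBoundedFormula ψ)
      (Sum.inr ⟨k, ψ⟩ : (skolemLanguage L).Functions n)}

/-! ### The model, its chain of submodels and the rank function `F` -/

/-- A linear order is `θ`-like if it has cardinality `θ` and each of its elements has fewer than
`θ` predecessors. -/
def IsLike (θ : Cardinal.{w}) (M : Type w) [LinearOrder M] : Prop :=
  #M = θ ∧ ∀ a : M, #(Set.Iio a) < θ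

/-- `⟨N i ; i < θ⟩` is a continuous chain, of length `θ` and with union `M`, of elementary
submodels of `M`, each later one being a proper end extension of each earlier one. (As all of them
are elementary in `M`, the later ones are elementary extensions of the earlier ones.)
The values `N i` for `i ≥ θ` are irrelevant. -/
structure IsElementaryEndChain {L' : FirstOrder.Language.{u, v}} {M : Type w} [L'.Structure M]
    [LinearOrder M] (θ : Cardinal.{w}) (N : Ordinal.{w} → L'.ElementarySubstructure M) :
    Prop where
  proper : ∀ i j, i < j → j < θ.ord → (N i : Set M) ⊂ (N j : Set M)
  endExtension : ∀ i j, i < j → j < θ.ord → ∀ x ∈ N i, ∀ y ∈ N j, y < x → y ∈ N i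
  continuous : ∀ i, i < θ.ord → Order.IsSuccLimit i →
    (N i : Set M) = ⋃ j ∈ Set.Iio i, (N j : Set M)
  exhausts : ∀ x : M, ∃ i < θ.ord, x ∈ N i

/-- `F a` is the least `i < θ` such that `a` belongs to the `i`-th member of the chain. -/
noncomputable def rank {M : Type w} (θ : Cardinal.{w}) (N : Ordinal.{w} → Set M) (a : M) :
    Ordinal.{w} :=
  sInf {i | i < θ.ord ∧ a ∈ N i}

/-! ### Superlarge sets -/

/-- `[X]^r`, as the set of strictly increasing sequences of length `r` of elements of `X`. -/
def incSeq {M : Type w} [LinearOrder M] (X : Set M) (r : ℕ) : Set (Fin r → M) :=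
  {x | StrictMono x ∧ ∀ j, x j ∈ X}

/-- `[F|A]^{r,s}`: the `s`-tuples of increasing `r`-sequences of elements of `A` such that `F` is
constant on each sequence and increases strictly from each sequence to the next. The set
`[F]^{r,s}` is the case `A = M`. -/
def blocks {M : Type w} [LinearOrder M] (F : M → Ordinal.{w}) (A : Set M) (r s : ℕ) :
    Set (Fin s → Fin r → M) :=
  {x | (∀ i, x i ∈ incSeq A r) ∧ (∀ i j l, F (x i j) = F (x i l)) ∧
    ∀ i i', i < i' → ∀ j l, F (x i j) < F (x i' l)}

/-- A strategy of player II in a game with `e` moves for each player. The `k`-th answer (counting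
from `0`) depends on the first `k + 1` moves of player I. The last move of II, the sequence
`⟨β_{e+i} ; i < θ⟩`, consists of the last answer `β_e` followed by `⟨β_{e+i} ; 1 ≤ i < θ⟩`, which
is `tail`. -/
structure Strategy (e : ℕ) where
  answer : (k : Fin e) → (Fin (k.val + 1) → Cardinal.{w}) → Ordinal.{w}
  tail : (Fin e → Cardinal.{w}) → Ordinal.{w} → Ordinal.{w}

/-- The answers `β_1, …, β_e` of II when I plays `μ_1, …, μ_e`. -/
def Strategy.play {e : ℕ} (Φ : Strategy.{w} e) (μ : Fin e → Cardinal.{w}) (k : Fin e) :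
    Ordinal.{w} :=
  Φ.answer k fun i => μ ⟨i.val, lt_of_lt_of_le i.isLt k.isLt⟩

/-- Player II wins the run of `G(S,e)` in which I has played `μ` and II has played
`β_1, …, β_e` (given by `β`) and `β_{e+i}`, `1 ≤ i < θ` (given by `γ i`). The sets `X_1, …, X_e`
are given by `X`, and `X_{e+i}`, `1 ≤ i < θ`, by `Z i`. In the supremum of the `|X_{e+i}|` the term
`|X_e| = μ_e < θ` is left out, which has no effect. -/
def PlayerIIWins {M : Type w} [LinearOrder M] (θ : Cardinal.{w}) (F : M → Ordinal.{w})
    (r s e : ℕ) (S : Set (Fin s → Fin r → M)) (μ : Fin e → Cardinal.{w})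
    (β : Fin e → Ordinal.{w}) (γ : Ordinal.{w} → Ordinal.{w}) : Prop :=
  (∀ k, β k < θ.ord) ∧ (∀ i ∈ Set.Ico 1 θ.ord, γ i < θ.ord) ∧
  StrictMono β ∧ (∀ k, ∀ i ∈ Set.Ico 1 θ.ord, β k < γ i) ∧ StrictMonoOn γ (Set.Ico 1 θ.ord) ∧
  ∃ (X : Fin e → Set M) (Z : Ordinal.{w} → Set M),
    (∀ k, X k ⊆ F ⁻¹' {β k} ∧ #(X k) = μ k) ∧
    (∀ i ∈ Set.Ico 1 θ.ord, Z i ⊆ F ⁻¹' {γ i}) ∧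
    IsLUB {c : Cardinal.{w} | ∃ i ∈ Set.Ico 1 θ.ord, c = #(Z i)} θ ∧
    ∀ x : Fin s → Fin r → M,
      (∀ (k : Fin s) (hk : k.val < e), x k ∈ incSeq (X ⟨k.val, hk⟩) r) →
      (fun k : Fin (s - e) => x ⟨e + k.val, by omega⟩) ∈
        blocks F (⋃ i ∈ Set.Ico 1 θ.ord, Z i) r (s - e) →
      x ∈ S

/-- `S ⊆ [F]^{r,s}` is `e`-superlarge, `1 ≤ e ≤ s`: player II has a winning strategy in the game
`G(S,e)`, in which player I plays cardinals below `θ`. -/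
def Superlarge {M : Type w} [LinearOrder M] (θ : Cardinal.{w}) (F : M → Ordinal.{w})
    (r s e : ℕ) (S : Set (Fin s → Fin r → M)) : Prop :=
  1 ≤ e ∧ e ≤ s ∧ S ⊆ blocks F Set.univ r s ∧
  ∃ Φ : Strategy.{w} e, ∀ μ : Fin e → Cardinal.{w}, (∀ k, μ k < θ) →
    PlayerIIWins θ F r s e S μ (Φ.play μ) (Φ.tail μ)

/-! ### The sentences of type (iv) -/

/-- The data of a sentence of type (iv), with constants `c_{ij}`, `(i, j) ∈ ℕ × ℕ`:
a term `τ(v_1, …, v_n)` whose variables are split as `Fin q ⊕ Fin m`, `m = n - q > 0`; the constants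
`c_{i_1 j_1}, …, c_{i_q j_q}` with first index `< i_n` (`head`); the constants
`c_{i_n j_{q+1}}, …, c_{i_n j_n}` with first index `i_n > 1` (`iota` and `block`); a constant
`c_{(i_n - 1) j}` (`bound`); and the constants `c_{u l_1}, …, c_{u l_{n-q}}` with `u ≥ i_n`. The
sequences of constants substituted into `τ` are strictly increasing. -/
structure TypeIV (L' : FirstOrder.Language.{u, v}) where
  q : ℕ
  m : ℕ
  m_pos : 0 < m
  τ : L'.Term (Fin q ⊕ Fin m)
  head : Fin q → ℕ × ℕ
  iota : ℕ
  block : Fin m → ℕ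
  bound : ℕ
  u : ℕ
  l : Fin m → ℕ
  one_lt_iota : 1 < iota
  head_lt : ∀ k, (head k).1 < iota
  head_strictMono : StrictMono fun k => toLex (head k)
  block_strictMono : StrictMono block
  iota_le_u : iota ≤ u
  l_strictMono : StrictMono l

namespace TypeIV

variable {L' : FirstOrder.Language.{u, v}} (σ : TypeIV L')

/-- The indices of the constants that occur in the sentence. -/
def indices : Set (ℕ × ℕ) :=
  Set.range σ.head ∪ Set.range (fun k => (σ.iota, σ.block k)) ∪ {(σ.iota - 1, σ.bound)} ∪
    Set.range (fun k => (σ.u, σ.l k))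

/-- The closed term obtained from `τ` by substituting constants for its variables. -/
def closedTerm (c : Fin σ.q ⊕ Fin σ.m → ℕ × ℕ) : L'[[ℕ × ℕ]].Term Empty :=
  ((L'.lhomWithConstants (ℕ × ℕ)).onTerm σ.τ).subst fun k => (L'.con (c k)).term

/-- The sentence
`τ(c̄, c_{i_n j_{q+1}}, …, c_{i_n j_n}) < c_{(i_n - 1) j} →
  τ(c̄, c_{i_n j_{q+1}}, …, c_{i_n j_n}) = τ(c̄, c_{u l_1}, …, c_{u l_{n-q}})`,
where `lt` is the symbol `<`. -/
def sentence (lt : L'.Relations 2) : L'[[ℕ × ℕ]].Sentence :=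
  (FirstOrder.Language.Relations.formula₂ ((L'.lhomWithConstants (ℕ × ℕ)).onRelation lt)
      (σ.closedTerm (Sum.elim σ.head fun k => (σ.iota, σ.block k)))
      (L'.con (σ.iota - 1, σ.bound)).term).imp
    ((σ.closedTerm (Sum.elim σ.head fun k => (σ.iota, σ.block k))).equal
      (σ.closedTerm (Sum.elim σ.head fun k => (σ.u, σ.l k))))

end TypeIV

/-- `M ⊨ φ` when each constant `c_{ij}` is interpreted by `f (i, j)`. -/
def SatisfiesWith {L' : FirstOrder.Language.{u, v}} {M : Type w} [L'.Structure M] (f : ℕ × ℕ → M)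
    (φ : L'[[ℕ × ℕ]].Sentence) : Prop :=
  letI : (FirstOrder.Language.constantsOn (ℕ × ℕ)).Structure M := FirstOrder.Language.constantsOn.structure f
  M ⊨ φ

/-- `M ⊨ φ(a)`: the sentence `φ` holds in `M` when each `c_{ij}`, `1 ≤ i ≤ s`, `1 ≤ j ≤ r`, is
replaced by `a_{ij}` (whatever the interpretation of the other constants). The rows and columns of
`a` are numbered from `0` in the code, hence the shift. -/
def Satisfies {L' : FirstOrder.Language.{u, v}} {M : Type w} [L'.Structure M] {r s : ℕ}
    (a : Fin s → Fin r → M) (φ : L'[[ℕ × ℕ]].Sentence) : Prop :=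
  ∀ f : ℕ × ℕ → M, (∀ i j, f (i.val + 1, j.val + 1) = a i j) → SatisfiesWith f φ

end KeislerGame

/-!
The set `S'` consists of the `a ∈ S` that satisfy the sentence, so only its superlargeness is at
stake. If II wins after `e` moves, then II can answer one more cardinal `μ` by picking from the tail
a set of size at least `μ`, and keep the later sets of the tail, whose sizes are still unbounded
(`PlayerIIWins.exists_next`, `Superlarge.succ`). Hence `S` is `(e' - 1)`-superlarge, and it is enough
that `S'` is `(e' - 1)`-superlarge too.

After `e' - 1` moves the parameters `c̄` and the bound in the sentence come from sets that are fixed,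
while the other arguments of `τ` come from the tail. All these parameters and bounds lie in a
proper initial part `D` of `M`, of size below `θ`. An increasing sequence `y` from the tail is coloured
by the function that sends `(c̄, b)` to `τ(c̄, y)` if this is below `b`, and to `none` otherwise
(`boundedValue`); since `D` is an initial part, the values lie in `D`, so there are fewer than `θ`
colours. By the Erdős–Rado theorem, each large enough set of the tail has a large homogeneous
subset, and by the regularity of `θ` one colour serves for subsets of unbounded sizes
(`exists_homogeneous_thinning`). With the tail thinned in this way, all sequences from the tail
give the same colour, which makes the sentence true (`PlayerIIWins.exists_thinning`).

The partition theorem (`exists_ramsey_bound`) is needed only in the form that `θ` is closed under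
some bound. The step from `m` to `m + 1` looks for an end-homogeneous sequence. Its members are
points named by well-founded trees of instructions; there are at most `2 ^ ρ` trees, so that in a
larger set some point `z` is not named by any of them. The sequence that imitates `z`
(`exists_endHomogeneous`) then never breaks off, as `z` itself meets each of the requests.
-/

namespace KeislerGame

/-! ### A partition theorem below a strongly inaccessible cardinal -/

/-- The point named by a tree of instructions. The root of a tree is labelled `⟨α, p⟩` and has one
child for each index below `α`; it asks for a point, different from those named by the children,
which together with each finite set `s` of them has colour `p s`. If there is none, the value is
arbitrary. -/
noncomputable def realizer {Z I C : Type w} [Nonempty Z] [DecidableEq Z] [LinearOrder I]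
    (f : Finset Z → C) : WType (fun a : Σ a : I, (Finset (Set.Iio a) → C) => Set.Iio a.1) → Z
  | ⟨a, b⟩ => Classical.epsilon fun x : Z => (∀ i, x ≠ realizer f (b i)) ∧
      ∀ s, f (insert x (s.image fun i => realizer f (b i))) = a.2 s

/-- The `α`-th tree of instructions that imitates `z`: its children are the earlier trees of the
sequence, and it prescribes the colours that `z` has over the points they name. -/
noncomputable def typeTree {Z I C : Type w} [Nonempty Z] [DecidableEq Z] [LinearOrder I]
    [WellFoundedLT I] (f : Finset Z → C) (z : Z) (α : I) :
    WType (fun a : Σ a : I, (Finset (Set.Iio a) → C) => Set.Iio a.1) :=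
  ⟨⟨α, fun s => f (insert z (s.image fun i => realizer f (typeTree f z i.1)))⟩,
    fun i => typeTree f z i.1⟩
termination_by (wellFounded_lt : WellFounded ((· < ·) : I → I → Prop)).wrap α
decreasing_by all_goals exact i.2

/-- An end-homogeneous sequence: the colour of a set does not depend on its last element. A point
`z` not named by any tree of instructions is copied at each step by a point that is. -/
theorem exists_endHomogeneous {Z I C : Type w} [DecidableEq Z] [LinearOrder I] [WellFoundedLT I]
    (f : Finset Z → C)
    (hZ : #(WType (fun a : Σ a : I, (Finset (Set.Iio a) → C) => Set.Iio a.1)) < #Z) :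
    ∃ (h : I ↪ Z) (z : Z), ∀ (α : I) (s : Finset I), (∀ i ∈ s, i < α) →
      f (insert (h α) (s.map h)) = f (insert z (s.map h)) := by
  have : Nonempty Z := by
    rw [← Cardinal.mk_ne_zero_iff]; exact (zero_le.trans_lt hZ).ne'
  obtain ⟨z, hz⟩ : ∃ z : Z, z ∉ Set.range (realizer f : WType _ → Z) := by
    by_contra! hcon
    exact (Cardinal.mk_le_of_surjective (f := (realizer f : WType (fun a : Σ a : I,
      (Finset (Set.Iio a) → C) => Set.Iio a.1) → Z)) hcon).not_gt hZ
  set t : I → Z := fun α => realizer f (typeTree f z α) with ht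
  have key (α : I) : (∀ i : Set.Iio α, t α ≠ t i.1) ∧ ∀ s : Finset (Set.Iio α),
      f (insert (t α) (s.image fun i => t i.1)) = f (insert z (s.image fun i => t i.1)) := by
    simp only [ht]
    rw [typeTree, realizer]
    exact Classical.epsilon_spec (p := fun x : Z => (∀ i : Set.Iio α, x ≠ t i.1) ∧
      ∀ s : Finset (Set.Iio α), f (insert x (s.image fun i => t i.1)) =
        f (insert z (s.image fun i => t i.1))) ⟨z, fun i hi => hz ⟨_, hi.symm⟩, fun s => rfl⟩
  have hinj : Function.Injective t := by
    intro a b hab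
    rcases lt_trichotomy a b with h | h | h
    · exact ((key b).1 ⟨a, h⟩ hab.symm).elim
    · exact h
    · exact ((key a).1 ⟨b, h⟩ hab).elim
  refine ⟨⟨t, hinj⟩, z, fun α s hs => ?_⟩
  have := (key α).2 (s.subtype (· ∈ Set.Iio α))
  have e : (s.subtype (· ∈ Set.Iio α)).image (fun i => t i.1) = s.map ⟨t, hinj⟩ := by
    ext x
    simp only [Finset.mem_image, Finset.mem_subtype, Finset.mem_map, Function.Embedding.coeFn_mk]
    constructor
    · rintro ⟨i, hi, rfl⟩; exact ⟨_, hi, rfl⟩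
    · rintro ⟨i, hi, rfl⟩; exact ⟨⟨i, hs i hi⟩, hi, rfl⟩
  rw [e] at this
  exact this

/-- Below a strongly inaccessible `θ`, every partition of the `m`-element subsets of a large enough
set into `κ` classes has a homogeneous set of size `l`. -/
theorem exists_ramsey_bound {θ : Cardinal.{w}} (hθ : θ.IsInaccessible) (m : ℕ)
    {κ l : Cardinal.{w}} (hκ : κ < θ) (hl : l < θ) :
    ∃ ν < θ, ∀ (Z C : Type w), ν ≤ #Z → #C ≤ κ → ∀ f : Finset Z → C,
      ∃ (H : Set Z) (c : C), l ≤ #H ∧ ∀ s : Finset Z, (s : Set Z) ⊆ H → s.card = m → f s = c := by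
  classical
  induction m with
  | zero =>
    refine ⟨l, hl, fun Z C hZ _ f => ⟨Set.univ, f ∅, by simpa using hZ, fun s _ hs => ?_⟩⟩
    rw [Finset.card_eq_zero.1 hs]
  | succ m ih =>
    obtain ⟨ν, hν, H⟩ := ih
    -- The bound `(2 ^ ρ)⁺` exceeds the number of trees of instructions over an index set of
    -- size `ν`, which is all that `exists_endHomogeneous` needs.
    set ρ : Cardinal.{w} := max ℵ₀ (max κ ν) with hρ
    have hρθ : ρ < θ := max_lt hθ.aleph0_lt (max_lt hκ hν)
    have hρ0 : ℵ₀ ≤ ρ := le_max_left _ _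
    have hνρ : ν ≤ ρ := (le_max_right _ _).trans (le_max_right _ _)
    have hκρ : κ ≤ ρ := (le_max_left _ _).trans (le_max_right _ _)
    refine ⟨Order.succ (2 ^ ρ), hθ.isSuccLimit.succ_lt (hθ.isStrongPrelimit hρθ),
      fun Z C hZ hC f => ?_⟩
    have hI : #ν.ord.ToType = ν := by simp
    have hIio (α : ν.ord.ToType) : #(Set.Iio α) ≤ ρ :=
      (Cardinal.mk_set_le _).trans (hI.le.trans hνρ)
    have h2 : (2 : Cardinal.{w}) ^ ρ = (2 ^ ρ) ^ ρ := by
      rw [← Cardinal.power_mul, Cardinal.mul_eq_self hρ0]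
    have hW : #(WType (fun a : Σ a : ν.ord.ToType, (Finset (Set.Iio a) → C) => Set.Iio a.1))
        ≤ 2 ^ ρ := by
      refine WType.cardinalMk_le_of_le ?_
      have h1 : ρ ≤ 2 ^ ρ := (Cardinal.cantor ρ).le
      have h3 : #(Σ a : ν.ord.ToType, (Finset (Set.Iio a) → C)) ≤ 2 ^ ρ := by
        rw [Cardinal.mk_sigma]
        calc Cardinal.sum (fun a : ν.ord.ToType => #(Finset (Set.Iio a) → C))
            ≤ Cardinal.sum (fun a : ν.ord.ToType => (2 ^ ρ : Cardinal.{w})) := by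
              refine Cardinal.sum_le_sum _ _ fun a => ?_
              have hfin : #(Finset (Set.Iio a)) ≤ ρ := by
                rcases finite_or_infinite (Set.Iio a) with h | h
                · exact (Cardinal.lt_aleph0_of_finite _).le.trans hρ0
                · rw [Cardinal.mk_finset_of_infinite]; exact hIio a
              rw [← Cardinal.power_def, h2]
              calc #C ^ #(Finset (Set.Iio a)) ≤ (2 ^ ρ) ^ #(Finset (Set.Iio a)) :=
                    Cardinal.power_le_power_right (hC.trans (hκρ.trans h1))
                _ ≤ (2 ^ ρ) ^ ρ := Cardinal.power_le_power_left
                    (Cardinal.power_ne_zero _ two_ne_zero) hfin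
          _ ≤ 2 ^ ρ := by
              rw [Cardinal.sum_const', hI]
              exact (mul_le_mul_left (hνρ.trans h1) _).trans
                (Cardinal.mul_eq_self (hρ0.trans h1)).le
      calc Cardinal.sum (fun a : Σ a : ν.ord.ToType, (Finset (Set.Iio a) → C) =>
              ((2 : Cardinal.{w}) ^ ρ) ^ #(Set.Iio a.1))
          ≤ Cardinal.sum (fun a : Σ a : ν.ord.ToType, (Finset (Set.Iio a) → C) =>
              ((2 : Cardinal.{w}) ^ ρ)) := by
            refine Cardinal.sum_le_sum _ _ fun a => ?_
            conv_rhs => rw [h2]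
            exact Cardinal.power_le_power_left (Cardinal.power_ne_zero _ two_ne_zero) (hIio a.1)
        _ ≤ 2 ^ ρ := by
            rw [Cardinal.sum_const']
            exact (mul_le_mul_left h3 _).trans (Cardinal.mul_eq_self (hρ0.trans h1)).le
    obtain ⟨h, z, hz⟩ := exists_endHomogeneous f
      (hW.trans_lt ((Order.lt_succ _).trans_le hZ))
    obtain ⟨A, c, hA, hc⟩ := H ν.ord.ToType C hI.ge hC fun s => f (insert z (s.map h))
    refine ⟨h '' A, c, by rwa [Cardinal.mk_image_eq h.injective], fun s hs hcard => ?_⟩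
    obtain ⟨t, ht, rfl⟩ := Finset.subset_set_image_iff.1 hs
    rw [Finset.card_image_of_injective _ h.injective] at hcard
    have hne : t.Nonempty := Finset.card_pos.1 (by omega)
    have hmax := t.max'_mem hne
    have e : t.image h = insert (h (t.max' hne)) ((t.erase (t.max' hne)).map h) := by
      rw [Finset.map_eq_image, ← Finset.image_insert, Finset.insert_erase hmax]
    rw [e, hz _ _ fun i hi => t.lt_max'_of_mem_erase_max' hne hi]
    refine hc _ (fun i hi => ht (Finset.mem_of_mem_erase hi)) ?_
    rw [Finset.card_erase_of_mem hmax, hcard, Nat.add_sub_cancel]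

/-- The partition theorem for subsets of a given type. -/
theorem exists_ramsey_bound_set {θ : Cardinal.{w}} (hθ : θ.IsInaccessible) (m : ℕ)
    {κ l : Cardinal.{w}} (hκ : κ < θ) (hl : l < θ) :
    ∃ ν < θ, ∀ (M C : Type w) (Z : Set M), ν ≤ #Z → #C ≤ κ → ∀ f : Finset M → C,
      ∃ (H : Set M) (c : C), H ⊆ Z ∧ l ≤ #H ∧
        ∀ s : Finset M, (s : Set M) ⊆ H → s.card = m → f s = c := by
  classical
  obtain ⟨ν, hν, h⟩ := exists_ramsey_bound hθ m hκ hl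
  refine ⟨ν, hν, fun M C Z hZ hC f => ?_⟩
  obtain ⟨H, c, hH, hc⟩ := h Z C hZ hC fun s => f (s.map (Function.Embedding.subtype _))
  refine ⟨Subtype.val '' H, c, by simp, by rwa [Cardinal.mk_image_eq Subtype.val_injective], ?_⟩
  intro s hs hcard
  obtain ⟨t, ht, rfl⟩ := Finset.subset_set_image_iff.1 hs
  rw [Finset.card_image_of_injective _ Subtype.val_injective] at hcard
  have := hc t ht hcard
  rwa [Finset.map_eq_image] at this

/-! ### Thinning a tail to a homogeneous one -/

theorem power_lt_of_isInaccessible {θ a b : Cardinal.{w}} (hθ : θ.IsInaccessible) (ha : a < θ)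
    (hb : b < θ) : a ^ b < θ := by
  refine lt_of_le_of_lt ?_
    (hθ.isStrongPrelimit (Cardinal.mul_lt_of_lt hθ.aleph0_lt.le ha hb))
  rw [Cardinal.power_mul]
  exact Cardinal.power_le_power_right (Cardinal.cantor a).le

/-- The sequence whose `j`-th term is the value of `g` at the supremum of `j` and all the earlier
terms. -/
noncomputable def escapeSeq (g : Ordinal.{w} → Ordinal.{w}) (j : Ordinal.{w}) : Ordinal.{w} :=
  g (max j (⨆ k : Set.Iio j, escapeSeq g k.1))
termination_by j
decreasing_by exact k.2

/-- If `g` moves each ordinal below a regular `θ` up, then `escapeSeq g` is evaluated at arguments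
below `θ`, and increases strictly. -/
theorem escapeSeq_spec {θ : Cardinal.{w}} (hθ : θ.IsRegular) {g : Ordinal.{w} → Ordinal.{w}}
    (hg : ∀ i < θ.ord, i < g i ∧ g i < θ.ord) :
    (∀ j < θ.ord, max j (⨆ k : Set.Iio j, escapeSeq g k.1) < θ.ord) ∧
      StrictMonoOn (escapeSeq g) (Set.Iio θ.ord) := by
  have h1 : ∀ j < θ.ord, max j (⨆ k : Set.Iio j, escapeSeq g k.1) < θ.ord := by
    intro j
    induction j using WellFoundedLT.induction with
    | ind j ih =>
      intro hj
      refine max_lt hj (Ordinal.lift_iSup_lt_of_lt_cof ?_ fun k => ?_)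
      · rw [Cardinal.lift_ord, (Cardinal.IsRegular.lift hθ).cof_ord,
          Cardinal.mk_Iio_ordinal, Cardinal.lift_lift, Cardinal.lift_umax.{w, w + 1}, Cardinal.lift_lt]
        exact Cardinal.lt_ord.1 hj
      · rw [escapeSeq]
        exact (hg _ (ih k.1 k.2 (k.2.trans hj))).2
  refine ⟨h1, fun i _ j hj hij => ?_⟩
  calc escapeSeq g i ≤ max j (⨆ k : Set.Iio j, escapeSeq g k.1) :=
        (Ordinal.le_iSup (fun k : Set.Iio j => escapeSeq g k.1) ⟨i, hij⟩).trans (le_max_right _ _)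
    _ < escapeSeq g j := by
        conv_rhs => rw [escapeSeq]
        exact (hg _ (h1 j hj)).1

/-- Given `θ` many sets of unbounded sizes and a colouring of the `m`-element sets with fewer than
`θ` colours, there are `θ` many homogeneous subsets, all of the same colour, whose sizes are still
unbounded: each set is thinned by the partition theorem, and as `θ` is regular, one of the colours
occurs on sets of unbounded sizes. -/
theorem exists_homogeneous_thinning {θ : Cardinal.{w}} (hθ : θ.IsInaccessible) {M C : Type w}
    (hC : #C < θ) (m : ℕ) (f : Finset M → C) (Z : Ordinal.{w} → Set M)
    (hZ : ∀ i < θ.ord, ∀ μ < θ, ∃ j, i < j ∧ j < θ.ord ∧ μ ≤ #(Z j)) :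
    ∃ (idx : Ordinal.{w} → Ordinal.{w}) (Y : Ordinal.{w} → Set M) (c : C),
      (∀ i < θ.ord, i < idx i ∧ idx i < θ.ord) ∧ StrictMonoOn idx (Set.Iio θ.ord) ∧
      ∀ i < θ.ord, Y i ⊆ Z (idx i) ∧ i.card ≤ #(Y i) ∧
        ∀ s : Finset M, (s : Set M) ⊆ Y i → s.card = m → f s = c := by
  obtain ⟨c, hc⟩ : ∃ c : C, ∀ i < θ.ord, ∃ (j : Ordinal.{w}) (H : Set M), i < j ∧ j < θ.ord ∧
      H ⊆ Z j ∧ i.card ≤ #H ∧ ∀ s : Finset M, (s : Set M) ⊆ H → s.card = m → f s = c := by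
    by_contra! hcon
    choose i hi hcon using hcon
    have hI : (⨆ c, i c) < θ.ord := Ordinal.iSup_lt_of_lt_cof (hC.trans_le hθ.le_cof_ord) hi
    obtain ⟨ν, hν, h⟩ := exists_ramsey_bound_set hθ m hC (Cardinal.lt_ord.1 hI)
    obtain ⟨j, hij, hj, hνj⟩ := hZ _ hI ν hν
    obtain ⟨H, c, hHZ, hH, hc⟩ := h M C (Z j) hνj le_rfl f
    have hic : i c ≤ ⨆ c, i c := Ordinal.le_iSup i c
    obtain ⟨s, hs, hsm, hsc⟩ := hcon c j H (hic.trans_lt hij) hj hHZ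
      ((Ordinal.card_le_card hic).trans hH)
    exact hsc (hc s hs hsm)
  have hc' : ∀ i : Ordinal.{w}, ∃ (j : Ordinal.{w}) (H : Set M), i < θ.ord → (i < j ∧ j < θ.ord) ∧
      H ⊆ Z j ∧ i.card ≤ #H ∧ ∀ s : Finset M, (s : Set M) ⊆ H → s.card = m → f s = c := by
    intro i
    by_cases hi : i < θ.ord
    · obtain ⟨j, H, h1, h2, h3⟩ := hc i hi
      exact ⟨j, H, fun _ => ⟨⟨h1, h2⟩, h3⟩⟩
    · exact ⟨0, ∅, fun h => (hi h).elim⟩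
  choose g H hgH using hc'
  obtain ⟨h1, h2⟩ := escapeSeq_spec hθ.isRegular fun i hi => (hgH i hi).1
  refine ⟨escapeSeq g, fun j => H (max j (⨆ k : Set.Iio j, escapeSeq g k.1)), c,
    fun i hi => ?_, h2, fun i hi => ?_⟩
  · have := (hgH _ (h1 i hi)).1
    rw [escapeSeq]
    exact ⟨(le_max_left _ _).trans_lt this.1, this.2⟩
  · have := (hgH _ (h1 i hi)).2
    rw [escapeSeq]
    exact ⟨this.1, (Ordinal.card_le_card (le_max_left _ _)).trans this.2.1, this.2.2⟩

/-! ### Moves in the game -/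

section Game

variable {θ : Cardinal.{w}} {M : Type w} {F : M → Ordinal.{w}}

theorem isLUB_mk_of_unbounded (hθ : θ.IsInaccessible)
    (hF : ∀ δ < θ.ord, #{a | F a ≤ δ} < θ) {γ : Ordinal.{w} → Ordinal.{w}}
    {Z : Ordinal.{w} → Set M} (hγ : ∀ i ∈ Set.Ico 1 θ.ord, γ i < θ.ord)
    (hZ : ∀ i ∈ Set.Ico 1 θ.ord, Z i ⊆ F ⁻¹' {γ i})
    (hun : ∀ μ < θ, ∃ i ∈ Set.Ico 1 θ.ord, μ ≤ #(Z i)) :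
    IsLUB {c : Cardinal.{w} | ∃ i ∈ Set.Ico 1 θ.ord, c = #(Z i)} θ := by
  constructor
  · rintro _ ⟨i, hi, rfl⟩
    exact ((Cardinal.mk_le_mk_of_subset fun a ha => (hZ i hi ha).le).trans_lt (hF _ (hγ i hi))).le
  · intro c hc
    by_contra! hlt
    obtain ⟨i, hi, h⟩ := hun _ (hθ.isSuccLimit.succ_lt hlt)
    exact (Order.lt_succ c).not_ge (h.trans (hc ⟨i, hi, rfl⟩))

/-- The sizes in the tail of a winning play remain unbounded beyond each index: the sets up to that
index all lie in an initial part of the model of size below `θ`. -/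
theorem exists_large_beyond (hF : ∀ δ < θ.ord, #{a | F a ≤ δ} < θ) (hθ : θ.IsInaccessible)
    {γ : Ordinal.{w} → Ordinal.{w}}
    {Z : Ordinal.{w} → Set M} (hγ : ∀ i ∈ Set.Ico 1 θ.ord, γ i < θ.ord)
    (hmono : StrictMonoOn γ (Set.Ico 1 θ.ord))
    (hZ : ∀ i ∈ Set.Ico 1 θ.ord, Z i ⊆ F ⁻¹' {γ i})
    (hlub : IsLUB {c : Cardinal.{w} | ∃ i ∈ Set.Ico 1 θ.ord, c = #(Z i)} θ)
    {i : Ordinal.{w}} (hi : i < θ.ord) {μ : Cardinal.{w}} (hμ : μ < θ) :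
    ∃ j, i < j ∧ j < θ.ord ∧ μ ≤ #(Z j) := by
  by_contra! hcon
  have h1 : (1 : Ordinal.{w}) < θ.ord := by
    rw [Cardinal.lt_ord]; simpa using hθ.nat_lt 1
  have hk : max i 1 ∈ Set.Ico 1 θ.ord := ⟨le_max_right _ _, max_lt hi h1⟩
  have hb : max μ #{a | F a ≤ γ (max i 1)} < θ := max_lt hμ (hF _ (hγ _ hk))
  refine hb.not_ge (hlub.2 ?_)
  rintro _ ⟨j, hj, rfl⟩
  rcases le_or_gt j (max i 1) with h | h
  · refine le_max_of_le_right (Cardinal.mk_le_mk_of_subset fun a ha => ?_)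
    exact (hZ j hj ha).le.trans (hmono.monotoneOn hj hk h)
  · exact le_max_of_le_left (hcon j ((le_max_left _ _).trans_lt h) hj.2).le

variable [LinearOrder M]

theorem blocks_mono {A B : Set M} (h : A ⊆ B) (r s : ℕ) : blocks F A r s ⊆ blocks F B r s :=
  fun _ hx => ⟨fun i => ⟨(hx.1 i).1, fun j => h ((hx.1 i).2 j)⟩, hx.2⟩

/-- From a position won by II after `e` moves, II can answer one more cardinal with a sufficiently
late member of the tail, and keep what lies beyond. -/
theorem PlayerIIWins.exists_next (hF : ∀ δ < θ.ord, #{a | F a ≤ δ} < θ) (hθ : θ.IsInaccessible)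
    {r s e : ℕ} (hes : e < s) {S : Set (Fin s → Fin r → M)} {μ : Fin e → Cardinal.{w}}
    {β : Fin e → Ordinal.{w}} {γ : Ordinal.{w} → Ordinal.{w}}
    (h : PlayerIIWins θ F r s e S μ β γ) {ν : Cardinal.{w}} (hν : ν < θ) :
    ∃ i, PlayerIIWins θ F r s (e + 1) S (Fin.snoc μ ν : Fin (e + 1) → Cardinal.{w})
      (Fin.snoc β (γ i) : Fin (e + 1) → Ordinal.{w}) (fun j => γ (i + j)) := by
  obtain ⟨hβ, hγ, hβm, hβγ, hγm, X, Z, hX, hZ, hlub, hS⟩ := h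
  have h0 : 0 < θ.ord := hθ.isRegular.ord_pos
  obtain ⟨i, hi0, hiθ, hνi⟩ := exists_large_beyond hF hθ hγ hγm hZ hlub h0 hν
  have hi : i ∈ Set.Ico 1 θ.ord := ⟨Order.one_le_iff_pos.2 hi0, hiθ⟩
  have hadd {j} (hj : j ∈ Set.Ico 1 θ.ord) : i + j ∈ Set.Ico 1 θ.ord :=
    ⟨hi.1.trans (le_self_add), Ordinal.isPrincipal_add_ord hθ.aleph0_lt.le hiθ hj.2⟩
  have hlt {j} (hj : j ∈ Set.Ico 1 θ.ord) : i < i + j :=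
    lt_add_of_pos_right _ (Order.one_le_iff_pos.1 hj.1)
  obtain ⟨Y, hYZ, hY⟩ := Cardinal.le_mk_iff_exists_subset.1 hνi
  refine ⟨i, ?_, fun j hj => hγ _ (hadd hj), ?_, ?_,
    fun j hj k hk hjk => hγm (hadd hj) (hadd hk) (by simpa using hjk),
    (Fin.snoc X Y : Fin (e + 1) → Set M), fun j => Z (i + j), ?_, fun j hj => hZ _ (hadd hj), ?_, ?_⟩
  · intro k
    induction k using Fin.lastCases with
    | last => simpa using hγ i hi
    | cast k => simpa using hβ k
  · intro k k' hkk
    induction k' using Fin.lastCases with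
    | last =>
      induction k using Fin.lastCases with
      | last => exact (lt_irrefl _ hkk).elim
      | cast k => simpa using hβγ k i hi
    | cast k' =>
      induction k using Fin.lastCases with
      | last => exact (hkk.trans (Fin.castSucc_lt_last k')).false.elim
      | cast k => simpa using hβm (Fin.castSucc_lt_castSucc_iff.1 hkk)
  · intro k j hj
    induction k using Fin.lastCases with
    | last => simpa using hγm hi (hadd hj) (hlt hj)
    | cast k => simpa using hβγ k _ (hadd hj)
  · intro k
    induction k using Fin.lastCases with
    | last => simpa using ⟨hYZ.trans (hZ i hi), hY⟩
    | cast k => simpa using hX k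
  · refine isLUB_mk_of_unbounded hθ hF (fun j hj => hγ _ (hadd hj)) (fun j hj => hZ _ (hadd hj))
      fun μ hμ => ?_
    obtain ⟨j, hij, hj, hμj⟩ := exists_large_beyond hF hθ hγ hγm hZ hlub hiθ hμ
    refine ⟨j - i, ⟨Order.one_le_iff_pos.2 (Ordinal.lt_sub.2 (by simpa using hij)),
      (Ordinal.sub_le_self _ _).trans_lt hj⟩, ?_⟩
    simpa [Ordinal.add_sub_cancel_of_le hij.le] using hμj
  · intro x hx ht
    have hxe : x ⟨e, hes⟩ ∈ incSeq Y r := by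
      simpa [Fin.snoc] using hx ⟨e, hes⟩ (Nat.lt_succ_self e)
    have hYF (j : Fin r) : F (x ⟨e, hes⟩ j) = γ i := hZ i hi (hYZ (hxe.2 j))
    have hlate (k : Fin s) (hk : e < k.val) (j : Fin r) :
        ∃ p ∈ Set.Ico 1 θ.ord, x k j ∈ Z (i + p) := by
      have := (ht.1 ⟨k.val - (e + 1), by omega⟩).2 j
      simp only [Set.mem_iUnion, exists_prop] at this
      convert this using 5
      ext; simp; omega
    have hlateF (k : Fin s) (hk : e < k.val) (j : Fin r) : γ i < F (x k j) := by
      obtain ⟨p, hp, hxp⟩ := hlate k hk j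
      rw [show F (x k j) = γ (i + p) from hZ _ (hadd hp) hxp]
      exact hγm hi (hadd hp) (hlt hp)
    have hrow (k : Fin s) (hk : e < k.val) :
        ∃ k' : Fin (s - (e + 1)), (⟨e + 1 + k'.val, by omega⟩ : Fin s) = k ∧
          k'.val = k.val - (e + 1) :=
      ⟨⟨k.val - (e + 1), by omega⟩, by ext; simp; omega, rfl⟩
    refine hS x (fun k hk => ?_) ⟨fun k => ⟨?_, fun j => ?_⟩, fun k j l => ?_, fun k k' hkk j l => ?_⟩
    · simpa [Fin.snoc, hk, Fin.castLT] using hx k (by omega)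
    · rcases Nat.eq_zero_or_pos k.val with h | h
      · simpa [h] using hxe.1
      · obtain ⟨k', e1, -⟩ := hrow ⟨e + k.val, by omega⟩ (by simpa using h)
        have := (ht.1 k').1
        simpa only [e1] using this
    · simp only [Set.mem_iUnion, exists_prop]
      rcases Nat.eq_zero_or_pos k.val with h | h
      · exact ⟨i, hi, by simpa [h] using hYZ (hxe.2 j)⟩
      · obtain ⟨p, hp, hxp⟩ := hlate ⟨e + k.val, by omega⟩ (by simpa using h) j
        exact ⟨i + p, hadd hp, hxp⟩
    · rcases Nat.eq_zero_or_pos k.val with h | h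
      · simp [h, hYF]
      · obtain ⟨k', e1, -⟩ := hrow ⟨e + k.val, by omega⟩ (by simpa using h)
        have := ht.2.1 k' j l
        simpa only [e1] using this
    · have hk' : 0 < k'.val := (Nat.zero_le _).trans_lt hkk
      rcases Nat.eq_zero_or_pos k.val with h | h
      · simpa [h, hYF] using hlateF ⟨e + k'.val, by omega⟩ (by simpa using hk') l
      · obtain ⟨p, e1, v1⟩ := hrow ⟨e + k.val, by omega⟩ (by simpa using h)
        obtain ⟨p', e2, v2⟩ := hrow ⟨e + k'.val, by omega⟩ (by simpa using hk')
        have := ht.2.2 p p' (by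
          rw [Fin.lt_def, v1, v2]
          have : k.val < k'.val := hkk
          simp only
          omega) j l
        simpa only [e1, e2] using this

/-- The answer to the new move depends only on the moves made so far, as the tail of a play is
determined by the first `e` moves of player I. -/
theorem Superlarge.succ (hF : ∀ δ < θ.ord, #{a | F a ≤ δ} < θ) (hθ : θ.IsInaccessible)
    {r s e : ℕ} (hes : e < s) {S : Set (Fin s → Fin r → M)} (h : Superlarge θ F r s e S) :
    Superlarge θ F r s (e + 1) S := by
  classical
  obtain ⟨h1, -, hS, Φ, hΦ⟩ := h
  have hnext : ∀ (μ : Fin e → Cardinal.{w}) (ν : Cardinal.{w}), ∃ i : Ordinal.{w},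
      (∀ k, μ k < θ) → ν < θ →
      PlayerIIWins θ F r s (e + 1) S (Fin.snoc μ ν : Fin (e + 1) → Cardinal.{w})
        (Fin.snoc (Φ.play μ) (Φ.tail μ i) : Fin (e + 1) → Ordinal.{w})
        (fun j => Φ.tail μ (i + j)) := by
    intro μ ν
    by_cases hμ : (∀ k, μ k < θ) ∧ ν < θ
    · obtain ⟨i, hi⟩ := (hΦ μ hμ.1).exists_next hF hθ hes hμ.2
      exact ⟨i, fun _ _ => hi⟩
    · exact ⟨0, fun a b => (hμ ⟨a, b⟩).elim⟩
  choose G hG using hnext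
  refine ⟨by omega, hes, hS, ⟨fun k μ => if hk : k.val < e then Φ.answer ⟨k.val, hk⟩ μ else
    Φ.tail (fun j => μ ⟨j.val, by omega⟩) (G (fun j => μ ⟨j.val, by omega⟩) (μ (Fin.last _))),
    fun μ j => Φ.tail (Fin.init μ) (G (Fin.init μ) (μ (Fin.last _)) + j)⟩, fun μ hμ => ?_⟩
  have := hG (Fin.init μ) (μ (Fin.last _)) (fun k => hμ _) (hμ _)
  rw [Fin.snoc_init_self] at this
  convert this using 1
  funext k
  induction k using Fin.lastCases with
  | last =>
    simp only [Strategy.play, Fin.val_last, lt_irrefl, dite_false, Fin.snoc_last]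
    rfl
  | cast k =>
    simp only [Strategy.play, Fin.val_castSucc, k.isLt, dite_true, Fin.snoc_castSucc]
    rfl

theorem Superlarge.of_le (hF : ∀ δ < θ.ord, #{a | F a ≤ δ} < θ) (hθ : θ.IsInaccessible)
    {r s e e' : ℕ} (hee' : e ≤ e') (he's : e' ≤ s) {S : Set (Fin s → Fin r → M)}
    (h : Superlarge θ F r s e S) : Superlarge θ F r s e' S := by
  induction e', hee' using Nat.le_induction with
  | base => exact h
  | succ e' _ ih => exact (ih (by omega)).succ hF hθ (by omega)

/-- To pass to another target set, it is enough to show that after the first `e` answers of II,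
which are kept, some last move wins: the game ends with that move, so nothing depends on it. -/
theorem Superlarge.of_exists_tail {r s e : ℕ} {S S' : Set (Fin s → Fin r → M)}
    (h : Superlarge θ F r s e S) (hS' : S' ⊆ blocks F Set.univ r s)
    (hT : ∀ (μ : Fin e → Cardinal.{w}) β γ, PlayerIIWins θ F r s e S μ β γ →
      ∃ γ', PlayerIIWins θ F r s e S' μ β γ') : Superlarge θ F r s e S' := by
  obtain ⟨h1, h2, -, Φ, hΦ⟩ := h
  have hT' : ∀ μ : Fin e → Cardinal.{w}, ∃ γ', (∀ k, μ k < θ) →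
      PlayerIIWins θ F r s e S' μ (Φ.play μ) γ' := by
    intro μ
    by_cases hμ : ∀ k, μ k < θ
    · obtain ⟨γ', h⟩ := hT _ _ _ (hΦ μ hμ)
      exact ⟨γ', fun _ => h⟩
    · exact ⟨0, fun h => (hμ h).elim⟩
  choose T hT' using hT'
  exact ⟨h1, h2, hS', ⟨Φ.answer, T⟩, hT'⟩

/-- The colour of an `m`-element set `{y₁ < … < yₘ}`: the function that sends parameters `p` and a
bound `b` in `D` to the value `g (p, y₁, …, yₘ)` if it is below `b` and
in `D`, and to `none` otherwise. The second condition is automatic when `D` is an initial part. -/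
noncomputable def boundedValue {q m : ℕ} (g : (Fin q ⊕ Fin m → M) → M) (D : Set M)
    (s : Finset M) (p : (Fin q → D) × D) : Option D := by
  classical
  exact if h : s.card = m then
    let y := g (Sum.elim (fun k => (p.1 k : M)) (s.orderEmbOfFin h))
    if h' : y < p.2 ∧ y ∈ D then some ⟨y, h'.2⟩ else none
  else none

theorem eq_of_boundedValue_eq {q m : ℕ} {g : (Fin q ⊕ Fin m → M) → M} {D : Set M}
    (hD : IsLowerSet D) {y y' : Fin m → M} (hy : StrictMono y) (hy' : StrictMono y')
    (h : boundedValue g D (Finset.univ.image y) = boundedValue g D (Finset.univ.image y'))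
    {p : Fin q → M} {b : M} (hp : ∀ k, p k ∈ D) (hb : b ∈ D) (hlt : g (Sum.elim p y) < b) :
    g (Sum.elim p y) = g (Sum.elim p y') := by
  classical
  have hc {y : Fin m → M} (hy : StrictMono y) : (Finset.univ.image y).card = m := by
    rw [Finset.card_image_of_injective _ hy.injective, Finset.card_univ, Fintype.card_fin]
  have ho {y : Fin m → M} (hy : StrictMono y) :
      ((Finset.univ.image y).orderEmbOfFin (hc hy) : Fin m → M) = y :=
    (Finset.orderEmbOfFin_unique (hc hy) (fun x => Finset.mem_image_of_mem y (Finset.mem_univ x))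
      hy).symm
  have h := congrFun h (fun k => ⟨p k, hp k⟩, ⟨b, hb⟩)
  simp only [boundedValue, hc hy, hc hy', dite_true, ho hy, ho hy'] at h
  rw [dif_pos ⟨hlt, hD hlt.le hb⟩] at h
  split_ifs at h with h'
  simpa using h

/-- After `e` moves of a play won by II, the tail can be thinned so that below a fixed bound the
values of `g` do not depend on the increasing arguments taken from the tail. The parameters and the
bound come from the first `e` rows, and so from an initial part of the model of size below `θ`;
this leaves fewer than `θ` colours for `boundedValue`. -/
theorem PlayerIIWins.exists_thinning (hF : ∀ δ < θ.ord, #{a | F a ≤ δ} < θ) (hmono : Monotone F)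
    (hθ : θ.IsInaccessible) {r s e : ℕ} (hes : e < s) {S : Set (Fin s → Fin r → M)}
    {μ : Fin e → Cardinal.{w}} {β : Fin e → Ordinal.{w}} {γ : Ordinal.{w} → Ordinal.{w}}
    (h : PlayerIIWins θ F r s e S μ β γ) {q m : ℕ} (g : (Fin q ⊕ Fin m → M) → M)
    {head : Fin q → Fin s × Fin r} (hhead : ∀ k, (head k).1.val < e)
    {bound : Fin s × Fin r} (hbound : bound.1.val < e) {block l : Fin m → Fin r}
    (hblock : StrictMono block) (hl : StrictMono l) {u : Fin s} (hu : e ≤ u.val) :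
    ∃ γ', PlayerIIWins θ F r s e (S ∩ {x |
      g (Sum.elim (fun k => x (head k).1 (head k).2) fun k => x ⟨e, hes⟩ (block k)) <
        x bound.1 bound.2 →
      g (Sum.elim (fun k => x (head k).1 (head k).2) fun k => x ⟨e, hes⟩ (block k)) =
        g (Sum.elim (fun k => x (head k).1 (head k).2) fun k => x u (l k))}) μ β γ' := by
  classical
  obtain ⟨hβ, hγ, hβm, hβγ, hγm, X, Z, hX, hZ, hlub, hS⟩ := h
  obtain ⟨δ, hδθ, hδ⟩ : ∃ δ < θ.ord, ∀ k, β k ≤ δ :=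
    ⟨Finset.univ.sup β, (Finset.sup_lt_iff hθ.isRegular.ord_pos).2 fun k _ => hβ k,
      fun k => Finset.le_sup (Finset.mem_univ k)⟩
  -- The first `e` rows lie in `D`, whatever their choice.
  set D : Set M := {a | F a ≤ δ} with hD
  have hDlow : IsLowerSet D := fun a b hab ha => (hmono hab).trans ha
  have hDθ : #D < θ := hF δ hδθ
  have hC : #((Fin q → D) × D → Option D) < θ := by
    have hq : #(Fin q → D) < θ := by
      rw [Cardinal.mk_arrow]
      exact power_lt_of_isInaccessible hθ (by simpa using hDθ) (by simpa using hθ.nat_lt q)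
    rw [← Cardinal.power_def, Cardinal.mk_option, Cardinal.mk_prod, Cardinal.lift_id,
      Cardinal.lift_id]
    exact power_lt_of_isInaccessible hθ
      (Cardinal.add_lt_of_lt hθ.aleph0_lt.le hDθ (by simpa using hθ.nat_lt 1))
      (Cardinal.mul_lt_of_lt hθ.aleph0_lt.le hq hDθ)
  obtain ⟨idx, Y, c, hidx, hidxm, hY⟩ := exists_homogeneous_thinning hθ hC m (boundedValue g D) Z
    fun i hi ν hν => exists_large_beyond hF hθ hγ hγm hZ hlub hi hν
  have hidx' {i} (hi : i ∈ Set.Ico 1 θ.ord) : idx i ∈ Set.Ico 1 θ.ord :=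
    ⟨hi.1.trans (hidx i hi.2).1.le, (hidx i hi.2).2⟩
  have hγm' : StrictMonoOn (fun i => γ (idx i)) (Set.Ico 1 θ.ord) :=
    fun i hi j hj hij => hγm (hidx' hi) (hidx' hj) (hidxm hi.2 hj.2 hij)
  have hYF : ∀ i ∈ Set.Ico 1 θ.ord, Y i ⊆ F ⁻¹' {γ (idx i)} :=
    fun i hi => (hY i hi.2).1.trans (hZ _ (hidx' hi))
  refine ⟨fun i => γ (idx i), hβ, fun i hi => hγ _ (hidx' hi), hβm,
    fun k i hi => hβγ k _ (hidx' hi), hγm', X, Y, hX, hYF, ?_, fun x hx ht => ⟨?_, ?_⟩⟩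
  · refine isLUB_mk_of_unbounded hθ hF (fun i hi => hγ _ (hidx' hi)) hYF fun ν hν => ?_
    have h1 : max 1 ν.ord < θ.ord :=
      max_lt (by rw [Cardinal.lt_ord]; simpa using hθ.nat_lt 1) (Cardinal.ord_lt_ord.2 hν)
    refine ⟨max 1 ν.ord, ⟨le_max_left _ _, h1⟩, le_trans ?_ (hY _ h1).2.1⟩
    calc ν = ν.ord.card := (Cardinal.card_ord ν).symm
      _ ≤ _ := Ordinal.card_le_card (le_max_right _ _)
  · refine hS x hx (blocks_mono ?_ _ _ ht)
    refine Set.iUnion₂_subset fun i hi => ?_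
    exact ((hY i hi.2).1).trans (Set.subset_biUnion_of_mem (u := Z) (hidx' hi))
  · -- A row of the tail has constant rank, and so lies in a single member of the thinned tail.
    have hrow (k : Fin s) (hk : e ≤ k.val) : StrictMono (x k) ∧
        ∃ i < θ.ord, ∀ j, x k j ∈ Y i := by
      have hk' : (⟨e + (k.val - e), by omega⟩ : Fin s) = k := by ext; simp; omega
      have h1 := ht.1 ⟨k.val - e, by omega⟩
      have h2 := ht.2.1 ⟨k.val - e, by omega⟩
      simp only [hk'] at h1 h2
      refine ⟨h1.1, ?_⟩
      have h3 : ∀ j, ∃ i ∈ Set.Ico 1 θ.ord, x k j ∈ Y i := by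
        simpa only [Set.mem_iUnion, exists_prop] using h1.2
      rcases Nat.eq_zero_or_pos r with h0 | h0
      · subst h0
        exact ⟨0, hθ.isRegular.ord_pos, fun j => j.elim0⟩
      obtain ⟨i, hi, hxi⟩ := h3 ⟨0, h0⟩
      refine ⟨i, hi.2, fun j => ?_⟩
      obtain ⟨i', hi', hxi'⟩ := h3 j
      have : γ (idx i') = γ (idx i) := by
        rw [← show F (x k j) = _ from hYF i' hi' hxi', ← show F (x k ⟨0, h0⟩) = _ from hYF i hi hxi]
        exact h2 _ _
      rwa [← hγm'.injOn hi' hi this]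
    have hcol (k : Fin s) (hk : e ≤ k.val) {y : Fin m → Fin r} (hy : StrictMono y) :
        boundedValue g D (Finset.univ.image fun j => x k (y j)) = c := by
      obtain ⟨hm, i, hi, hxi⟩ := hrow k hk
      refine (hY i hi).2.2 _ ?_ ?_
      · intro a ha
        simp only [Finset.coe_image, Finset.coe_univ, Set.image_univ, Set.mem_range] at ha
        obtain ⟨j, rfl⟩ := ha
        exact hxi _
      · rw [Finset.card_image_of_injective (f := fun j => x k (y j)) _ (hm.comp hy).injective,
          Finset.card_univ, Fintype.card_fin]
    have hearly (p : Fin s × Fin r) (hp : p.1.val < e) : x p.1 p.2 ∈ D := by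
      have := (hX ⟨p.1.val, hp⟩).1 ((hx p.1 hp).2 p.2)
      exact (show F _ = _ from this).le.trans (hδ _)
    exact eq_of_boundedValue_eq hDlow ((hrow _ le_rfl).1.comp hblock) ((hrow u hu).1.comp hl)
      ((hcol ⟨e, hes⟩ le_rfl hblock).trans (hcol u hu hl).symm) (fun k => hearly _ (hhead k))
      (hearly _ hbound)

end Game

/-! ### The rank function of the chain -/

section Chain

variable {θ : Cardinal.{w}} {L' : FirstOrder.Language.{u, v}} {M : Type w} [L'.Structure M]
  {N : Ordinal.{w} → L'.ElementarySubstructure M}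

theorem rank_le {i : Ordinal.{w}} {a : M} (hi : i < θ.ord) (ha : a ∈ N i) :
    rank θ (fun i => (N i : Set M)) a ≤ i :=
  csInf_le' (s := {i | i < θ.ord ∧ a ∈ (N i : Set M)}) ⟨hi, ha⟩

variable [LinearOrder M]

theorem IsElementaryEndChain.rank_mem (hN : IsElementaryEndChain θ N) (a : M) :
    rank θ (fun i => (N i : Set M)) a < θ.ord ∧ a ∈ N (rank θ (fun i => (N i : Set M)) a) :=
  csInf_mem (s := {i | i < θ.ord ∧ a ∈ (N i : Set M)}) (hN.exhausts a)

theorem IsElementaryEndChain.mem_of_lt (hN : IsElementaryEndChain θ N) {i : Ordinal.{w}}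
    (hi : i < θ.ord) {a b : M} (hb : b ∈ N i) (hab : a < b) : a ∈ N i := by
  obtain ⟨j, hj, haj⟩ := hN.exhausts a
  rcases lt_or_ge i j with h | h
  · exact hN.endExtension i j h hj b hb a haj hab
  · rcases h.eq_or_lt with rfl | h
    · exact haj
    · exact (hN.proper j i h hi).1 haj

theorem IsElementaryEndChain.monotone_rank (hN : IsElementaryEndChain θ N) :
    Monotone (rank θ fun i => (N i : Set M)) := by
  intro a b hab
  rcases hab.eq_or_lt with rfl | hab
  · exact le_rfl
  · obtain ⟨h, hb⟩ := hN.rank_mem b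
    exact rank_le h (hN.mem_of_lt h hb hab)

/-- An initial part of a `θ`-like model given by the rank is bounded by a point of the next member
of the chain, and so is small. -/
theorem IsElementaryEndChain.mk_rank_le_lt (hN : IsElementaryEndChain θ N)
    (hθ : θ.IsInaccessible) (hM : IsLike θ M) {δ : Ordinal.{w}} (hδ : δ < θ.ord) :
    #{a : M | rank θ (fun i => (N i : Set M)) a ≤ δ} < θ := by
  have hδ' : Order.succ δ < θ.ord :=
    (Cardinal.isSuccLimit_ord hθ.aleph0_lt.le).succ_lt hδ
  obtain ⟨x, -, hx⟩ := Set.exists_of_ssubset (hN.proper δ _ (Order.lt_succ δ) hδ')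
  refine lt_of_le_of_lt (Cardinal.mk_le_mk_of_subset fun a ha => ?_) (hM.2 x)
  obtain ⟨-, h⟩ := hN.rank_mem a
  have haδ : a ∈ N δ := by
    rcases (show _ ≤ δ from ha).eq_or_lt with h' | h'
    · rwa [h'] at h
    · exact (hN.proper _ δ h' hδ).1 h
  by_contra hxa
  rcases (not_lt.1 hxa).eq_or_lt with rfl | h'
  · exact hx haδ
  · exact hx (hN.mem_of_lt hδ haδ h')

end Chain

/-! ### The truth of sentences of type (iv) -/

/-- The truth of a sentence of type (iv) is a statement on the values of its term `τ`. -/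
theorem satisfiesWith_sentence {L' : FirstOrder.Language.{u, v}} {M : Type w} [L'.Structure M]
    [LinearOrder M] {lt : L'.Relations 2}
    (hlt : ∀ x y : M, FirstOrder.Language.Structure.RelMap lt ![x, y] ↔ x < y)
    (σ : TypeIV L') (f : ℕ × ℕ → M) :
    SatisfiesWith f (σ.sentence lt) ↔
      (σ.τ.realize (Sum.elim (fun k => f (σ.head k)) fun k => f (σ.iota, σ.block k)) <
          f (σ.iota - 1, σ.bound) →
        σ.τ.realize (Sum.elim (fun k => f (σ.head k)) fun k => f (σ.iota, σ.block k)) =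
          σ.τ.realize (Sum.elim (fun k => f (σ.head k)) fun k => f (σ.u, σ.l k))) := by
  let _ : (FirstOrder.Language.constantsOn (ℕ × ℕ)).Structure M :=
    FirstOrder.Language.constantsOn.structure f
  have hcon (p : ℕ × ℕ) (v : Empty → M) : (L'.con p).term.realize v = f p :=
    FirstOrder.Language.Term.realize_constants
  have hterm (c : Fin σ.q ⊕ Fin σ.m → ℕ × ℕ) (v : Empty → M) :
      (σ.closedTerm c).realize v = σ.τ.realize fun k => f (c k) := by
    rw [TypeIV.closedTerm, FirstOrder.Language.Term.realize_subst,
      FirstOrder.Language.LHom.realize_onTerm]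
    simp only [hcon]
  have helim (g : Fin σ.m → ℕ × ℕ) : (fun k => f (Sum.elim σ.head g k)) =
      Sum.elim (fun k => f (σ.head k)) fun k => f (g k) := by
    funext k; cases k <;> rfl
  have hrel (x y : M) : FirstOrder.Language.Structure.RelMap
      ((L'.lhomWithConstants (ℕ × ℕ)).onRelation lt) ![x, y] ↔ x < y := by
    rw [← hlt, FirstOrder.Language.LHom.map_onRelation]
  rw [SatisfiesWith, TypeIV.sentence, FirstOrder.Language.Sentence.Realize,
    FirstOrder.Language.Formula.realize_imp, FirstOrder.Language.Formula.realize_rel₂,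
    FirstOrder.Language.Formula.realize_equal]
  simp only [hterm, hcon, hrel, helim]

end KeislerGame

theorem proposition3p3
    -- a countable language with a symbol for the order, and a strongly inaccessible cardinal
    {L : FirstOrder.Language.{u, u}} (hL : Countable L.Symbols) (lt : L.Relations 2)
    (θ : Cardinal.{w}) (hθ : θ.IsInaccessible)
    -- a `θ`-like model with Skolem functions
    {M : Type w} [LinearOrder M] [(KeislerGame.skolemLanguage L).Structure M]
    (hlt : ∀ x y : M, FirstOrder.Language.Structure.RelMap (L := KeislerGame.skolemLanguage L)
      (lt : (KeislerGame.skolemLanguage L).Relations 2) ![x, y] ↔ x < y)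
    (hskolem : M ⊨ KeislerGame.skolemTheory L)
    (hM : KeislerGame.IsLike θ M)
    -- the chain of elementary submodels and its rank function
    (N : Ordinal.{w} → (KeislerGame.skolemLanguage L).ElementarySubstructure M)
    (hN : KeislerGame.IsElementaryEndChain θ N)
    (F : M → Ordinal.{w}) (hF : F = KeislerGame.rank θ fun i => (N i : Set M))
    -- an `e`-superlarge set and a sentence of type (iv)
    (r s e e' : ℕ) (hr : 0 < r) (hes : e < s)
    (S : Set (Fin s → Fin r → M)) (hS : KeislerGame.Superlarge θ F r s e S)
    (σ : KeislerGame.TypeIV (KeislerGame.skolemLanguage L))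
    (hσ : ∀ p ∈ σ.indices, 1 ≤ p.1 ∧ p.1 ≤ s ∧ 1 ≤ p.2 ∧ p.2 ≤ r)
    (hι : σ.iota = e') (hee' : e < e') :
    ∃ S' : Set (Fin s → Fin r → M), S' ⊆ S ∧ KeislerGame.Superlarge θ F r s e' S' ∧
      ∀ a ∈ S', KeislerGame.Satisfies a (σ.sentence lt) := by
  have hmono : Monotone F := hF ▸ hN.monotone_rank
  have hsmall : ∀ δ < θ.ord, #{a | F a ≤ δ} < θ := by
    subst hF; exact fun δ hδ => hN.mk_rank_le_lt hθ hM hδ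
  have hhead (k) := hσ (σ.head k) (Or.inl (Or.inl (Or.inl ⟨k, rfl⟩)))
  have hblock (k) := hσ (σ.iota, σ.block k) (Or.inl (Or.inl (Or.inr ⟨k, rfl⟩)))
  have hbound := hσ (σ.iota - 1, σ.bound) (Or.inl (Or.inr rfl))
  have hl (k) := hσ (σ.u, σ.l k) (Or.inr ⟨k, rfl⟩)
  have hhead_lt := σ.head_lt
  have hιs : σ.iota ≤ s := (hblock ⟨0, σ.m_pos⟩).2.1
  have hus : σ.u ≤ s := (hl ⟨0, σ.m_pos⟩).2.1
  have hιu := σ.iota_le_u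
  have hι1 := σ.one_lt_iota
  simp only at hblock hbound hl
  -- The constants, with rows and columns numbered from `0`.
  set head : Fin σ.q → Fin s × Fin r := fun k =>
    (⟨(σ.head k).1 - 1, by have := hhead k; omega⟩, ⟨(σ.head k).2 - 1, by have := hhead k; omega⟩)
    with hhead_def
  set block : Fin σ.m → Fin r := fun k => ⟨σ.block k - 1, by have := hblock k; omega⟩
    with hblock_def
  set bound : Fin s × Fin r := (⟨σ.iota - 1 - 1, by omega⟩, ⟨σ.bound - 1, by omega⟩)
    with hbound_def
  set u : Fin s := ⟨σ.u - 1, by omega⟩ with hu_def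
  set l : Fin σ.m → Fin r := fun k => ⟨σ.l k - 1, by have := hl k; omega⟩ with hl_def
  have hes' : e' - 1 < s := by omega
  set T : Set (Fin s → Fin r → M) := S ∩ {x |
      σ.τ.realize (Sum.elim (fun k => x (head k).1 (head k).2) fun k => x ⟨e' - 1, hes'⟩ (block k))
        < x bound.1 bound.2 →
      σ.τ.realize (Sum.elim (fun k => x (head k).1 (head k).2) fun k => x ⟨e' - 1, hes'⟩ (block k))
        = σ.τ.realize (Sum.elim (fun k => x (head k).1 (head k).2) fun k => x u (l k))} with hT
  -- The tail is thinned after `e' - 1` moves, when the parameters and the bound are confined to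
  -- the rows already played and row `e'` still belongs to the tail.
  have hSe : KeislerGame.Superlarge θ F r s (e' - 1) S :=
    hS.of_le hsmall hθ (by omega) (by omega)
  have hTe : KeislerGame.Superlarge θ F r s (e' - 1) T :=
    hSe.of_exists_tail (Set.inter_subset_left.trans hSe.2.2.1) fun μ β γ h =>
      h.exists_thinning hsmall hmono hθ hes' (fun v => σ.τ.realize v)
        (fun k => by have := hhead k; have := hhead_lt k; simp only [hhead_def]; omega)
        (by simp only [hbound_def]; omega)
        (fun i j hij => by
          have := σ.block_strictMono hij
          have := hblock i
          simp only [hblock_def, Fin.mk_lt_mk]; omega)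
        (fun i j hij => by
          have := σ.l_strictMono hij
          have := hl i
          simp only [hl_def, Fin.mk_lt_mk]; omega)
        (by simp only [hu_def]; omega)
  refine ⟨T, Set.inter_subset_left, ?_, fun a ha f hf => ?_⟩
  · have := hTe.succ hsmall hθ hes'
    rwa [Nat.sub_add_cancel (by omega)] at this
  · have h1 (k) : f (σ.head k) = a (head k).1 (head k).2 := by
      rw [← hf]; congr 1; have := hhead k; ext <;> simp only [hhead_def] <;> omega
    have h2 (k) : f (σ.iota, σ.block k) = a ⟨e' - 1, hes'⟩ (block k) := by
      rw [← hf]; congr 1; have := hblock k; ext <;> simp only [hblock_def] <;> omega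
    have h3 : f (σ.iota - 1, σ.bound) = a bound.1 bound.2 := by
      rw [← hf]; congr 1; ext <;> simp only [hbound_def] <;> omega
    have h4 (k) : f (σ.u, σ.l k) = a u (l k) := by
      rw [← hf]; congr 1; have := hl k; ext <;> simp only [hu_def, hl_def] <;> omega
    rw [KeislerGame.satisfiesWith_sentence hlt]
    simp only [h1, h2, h3, h4]
    exact ha.2
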